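/- Let $V$ be a separable reflexive real Banach space with norm $\|\cdot\|$, $H$ a separable real Hilbert space, and $i:V\to H$ a linear injective compact map with dense range, so that $V\subset H\subset V^*$ is an evolution triple; write $\langle\cdot,\cdot\rangle$ for the pairing of $V^*$ and $V$, and $\|v\|_H$, $(u,v)_H$ for $\|iv\|_H$, $(iu,iv)_H$ when $u,v\in V$. Let $U$ be a reflexive real Banach space and $0<T<\infty$. For locally Lipschitz $J:U\to\mathbb R$ put $J^0(u;z)=\limsup_{y\to u,\ \lambda\to0^+}\frac{J(y+\lambda z)-J(y)}{\lambda}$ and $\partial J(u)=\{\xi\in U^*:\ \langle\xi,z\rangle_{U^*\times U}\le J^0(u;z)\ \text{for all } z\in U\}$ (the Clarke derivative and gradient). A multifunction $B:V\to 2^{V^*}$ is called pseudomonotone if (i) its values are nonempty, weakly compact and convex; (ii) it is upper semicontinuous from every finite-dimensional subspace of $V$ into $V^*$ with the weak topology; (iii) if $v_n\to v$ weakly in $V$, $v_n^*\in B(v_n)$ and $\limsup_n\langle v_n^*,v_n-v\rangle\le0$, then for every $y\in V$ there is $w\in B(v)$ with $\langle w,v-y\rangle\le\liminf_n\langle v_n^*,v_n-y\rangle$.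 A map $A:V\to V^*$ is pseudomonotone if $v\mapsto\{A(v)\}$ is. Assume: - $H(A)$: $A:V\to V^*$ is pseudomonotone; $\|A(v)\|_{V^*}\le a+b\|v\|$ and $\langle A(v),v\rangle\ge\alpha\|v\|^2-\beta\|v\|_H^2$ for all $v\in V$, with constants $a\ge0$, $b>0$, $\alpha>0$, $\beta\ge0$. - $H(J)$: $J:U\to\mathbb R$ is locally Lipschitz, and $\|\xi\|_{U^*}\le c(1+\|u\|_U)$ for all $u\in U$, $\xi\in\partial J(u)$, with a constant $c>0$. - $H_0$: $f\in L^2(0,T;V^*)$ and $u_0\in H$. - $H(U)$: $\iota:V\to U$ is linear, continuous and compact, and the map $v\mapsto\iota(v(\cdot))$ from $M^{2,2}(0,T;V,V^*)=L^2(0,T;V)\cap BV^2(0,T;V^*)$ to $L^2(0,T;U)$ is compact (it maps bounded sets to relatively compact sets). Here $\|x\|^2_{BV^2(0,T;V^*)}$ is the supremum of $\sum_{k}\|x(t_{k+1})-x(t_k)\|_{V^*}^2$ over all partitions $0=t_0<\dots<t_m=T$, and the norm of $M^{2,2}(0,T;V,V^*)$ is the sum of the $L^2(0,T;V)$ norm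 and this seminorm. - $H_{aux}$: at least one of the following holds. A) There is a linear continuous $p:H\to U$ with $p(i(v))=\iota(v)$ for all $v\in V$. B) $\alpha>c\|\iota\|^2_{\mathcal L(V;U)}$. C) There are $d\ge0$ and $1\le\sigma<2$ with $J^0(u;-u)\le d(1+\|u\|_U^\sigma)$ for all $u\in U$. Then there exists $\tau_0>0$ such that the following holds for all discretization data consisting of: time steps $\tau_n>0$ with $\tau_n\to0$ and $N_n=T/\tau_n$ an integer; $\epsilon_n>0$ with $\epsilon_n\to0$; mollifiers $\rho_n\in C^\infty(\mathbb R)$ with $\rho_n\ge0$, support in $[-\epsilon_n,\epsilon_n]$ and $\int_{\mathbb R}\rho_n=1$; and $u_{0,n}\in V$ with $u_{0,n}\to u_0$ in $H$ and $\|u_{0,n}\|\le C/\sqrt{\tau_n}$ for some constant $C>0$. Put $$f_n^k=\int_0^T\rho_n\Big(k\tau_n+\epsilon_n\frac{T-2k\tau_n}{T}-s\Big)f(s)\,ds\in V^*,\qquad k=1,\dots,N_n .$$ For every $n$ with $\tau_n<\tau_0$ there are $u^0,\dots,u^{N_n}\in V$ such that $u^0=u_{0,n}$ and for every $k=1,\dots,N_n$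 there is $\xi^k\in\partial J(\iota u^k)$ with $$\Big(\frac{u^k-u^{k-1}}{\tau_n},v\Big)_H+\langle A(u^k),v\rangle+\langle\xi^k,\iota v\rangle_{U^*\times U}=\langle f_n^k,v\rangle\qquad\text{for all } v\in V .$$ -/

import Mathlib

open MeasureTheory Filter Topology
open scoped ENNReal NNReal ContDiff

noncomputable section

namespace Rothe

/-- A normed space is reflexive if the canonical map into its bidual is onto. -/
def IsReflexiveSpace (X : Type*) [NormedAddCommGroup X] [NormedSpace ℝ X] : Prop :=
  Function.Surjective (NormedSpace.inclusionInDoubleDual ℝ X)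

/-- Weak convergence `x n ⇀ x` of a sequence in a normed space. -/
def WeakTendsto {X : Type*} [NormedAddCommGroup X] [NormedSpace ℝ X] (x : ℕ → X) (x₀ : X) : Prop :=
  Tendsto (fun n => toWeakSpace ℝ X (x n)) atTop (𝓝 (toWeakSpace ℝ X x₀))

/-- Clarke's generalized directional derivative
`j⁰(x; z) = limsup_{y → x, t → 0⁺} (j (y + t z) - j y) / t`, with the `limsup` taken in the extended
reals. It is finite when `j` is locally Lipschitz. -/
def clarkeDeriv {X : Type*} [NormedAddCommGroup X] [NormedSpace ℝ X] (j : X → ℝ) (x z : X) :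
    EReal :=
  limsup (fun q : X × ℝ => (((j (q.1 + q.2 • z) - j q.1) / q.2 : ℝ) : EReal)) (𝓝 x ×ˢ 𝓝[>] (0 : ℝ))

/-- Clarke's generalized gradient `∂j(x) ⊆ X*`. -/
def clarkeSubdiff {X : Type*} [NormedAddCommGroup X] [NormedSpace ℝ X] (j : X → ℝ) (x : X) :
    Set (StrongDual ℝ X) :=
  {ξ | ∀ z : X, ((ξ z : ℝ) : EReal) ≤ clarkeDeriv j x z}

/-- Pseudomonotone multifunctions `A : X → 2^{X*}` on a (reflexive) Banach space. The inferior and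
superior limits are taken in the extended reals. -/
structure IsPseudomonotone {X : Type*} [NormedAddCommGroup X] [NormedSpace ℝ X]
    (A : X → Set (StrongDual ℝ X)) : Prop where
  nonempty : ∀ x, (A x).Nonempty
  convex : ∀ x, Convex ℝ (A x)
  weaklyCompact : ∀ x, IsCompact (toWeakSpace ℝ (StrongDual ℝ X) '' A x)
  usc : ∀ F : Submodule ℝ X, FiniteDimensional ℝ F →
    UpperHemicontinuousOn (fun x => toWeakSpace ℝ (StrongDual ℝ X) '' A x) (F : Set X)
  liminf_ge : ∀ (v : ℕ → X) (v₀ : X) (w : ℕ → StrongDual ℝ X),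
    WeakTendsto v v₀ → (∀ n, w n ∈ A (v n)) →
    limsup (fun n => ((w n (v n - v₀) : ℝ) : EReal)) atTop ≤ 0 →
    ∀ y : X, ∃ w₀ ∈ A v₀,
      ((w₀ (v₀ - y) : ℝ) : EReal) ≤ liminf (fun n => ((w n (v n - y) : ℝ) : EReal)) atTop

/-- The Lebesgue measure on the interval `(0, T)`. -/
abbrev timeMeasure (T : ℝ) : Measure ℝ := volume.restrict (Set.Ioo 0 T)

/-- The seminorm of `BV^q(0,T;Z)`, for `1 ≤ q < ∞`:
`‖x‖^q = sup ∑ ‖x (t_{k+1}) - x (t_k)‖^q` over all partitions `0 = t_0 < ⋯ < t_n = T`. -/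
def bvSeminorm {Z : Type*} [NormedAddCommGroup Z] (q : ℝ) (T : ℝ) (x : ℝ → Z) : ℝ≥0∞ :=
  (⨆ (n : ℕ) (t : Fin (n + 1) → ℝ) (_ : StrictMono t) (_ : t 0 = 0) (_ : t (Fin.last n) = T),
    ∑ k : Fin n, ‖x (t k.succ) - x (t k.castSucc)‖ₑ ^ q) ^ (1 / q)

section EvolutionTriple

variable {V H U : Type*} [NormedAddCommGroup V] [NormedSpace ℝ V]
  [NormedAddCommGroup H] [InnerProductSpace ℝ H] [NormedAddCommGroup U] [NormedSpace ℝ U]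

/-- The embedding `i : V → H` of an evolution triple `V ⊂ H ⊂ V*` with continuous, dense and compact
embeddings. -/
structure IsEvolutionEmbedding (i : V →L[ℝ] H) : Prop where
  injective : Function.Injective i
  denseRange : DenseRange i
  compact : IsCompactOperator i

/-- The induced embedding `V ⊂ H ⊂ V*`, i.e. `v ↦ (i v, i ·)_H`. -/
def toDualEmb (i : V →L[ℝ] H) (v : V) : StrongDual ℝ V :=
  (innerSL ℝ (i v)).comp i

/-- The norm of `M^{2,2}(0,T;V,V*) = L²(0,T;V) ∩ BV²(0,T;V*)` (infinite outside this space, for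
strongly measurable `v`). -/
def normM22 (i : V →L[ℝ] H) (T : ℝ) (v : ℝ → V) : ℝ≥0∞ :=
  eLpNorm v 2 (timeMeasure T) + bvSeminorm 2 T (fun t => toDualEmb i (v t))

/-- The Nemytskii map `v ↦ (t ↦ ι (v t))` from `M^{2,2}(0,T;V,V*)` to `L²(0,T;U)` is compact: it
maps bounded sets to relatively compact sets. -/
def NemytskiiCompact (i : V →L[ℝ] H) (T : ℝ) (ι : V →L[ℝ] U) : Prop :=
  ∀ R : ℝ≥0, IsCompact (closure {w : Lp U 2 (timeMeasure T) |
    ∃ v : ℝ → V, AEStronglyMeasurable v (timeMeasure T) ∧ normM22 i T v ≤ R ∧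
      w =ᵐ[timeMeasure T] fun t => ι (v t)})

/-- Assumption `H(A)` on the operator `A : V → V*`, with its constants. -/
structure HypA (i : V →L[ℝ] H) (A : V → StrongDual ℝ V) (a b α β : ℝ) : Prop where
  pseudomonotone : IsPseudomonotone (fun v => ({A v} : Set (StrongDual ℝ V)))
  a_nonneg : 0 ≤ a
  b_pos : 0 < b
  growth : ∀ v, ‖A v‖ ≤ a + b * ‖v‖
  α_pos : 0 < α
  β_nonneg : 0 ≤ β
  coercive : ∀ v, α * ‖v‖ ^ 2 - β * ‖i v‖ ^ 2 ≤ A v v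

/-- Assumption `H(J)` on the functional `J : U → ℝ`, with its constant. -/
structure HypJ (J : U → ℝ) (c : ℝ) : Prop where
  locallyLipschitz : LocallyLipschitz J
  c_pos : 0 < c
  growth : ∀ u, ∀ ξ ∈ clarkeSubdiff J u, ‖ξ‖ ≤ c * (1 + ‖u‖)

/-- Assumption `H(U)` on the map `ι : V → U`. -/
structure HypU (i : V →L[ℝ] H) (T : ℝ) (ι : V →L[ℝ] U) : Prop where
  compact : IsCompactOperator ι
  nemytskii_compact : NemytskiiCompact i T ι

/-- Assumption `H_aux`: one of the alternatives A), B), C) holds. -/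
def HypAux (i : V →L[ℝ] H) (ι : V →L[ℝ] U) (J : U → ℝ) (α c : ℝ) : Prop :=
  (∃ p : H →L[ℝ] U, ∀ v, p (i v) = ι v) ∨
  c * ‖ι‖ ^ 2 < α ∨
  (∃ d σ : ℝ, 0 ≤ d ∧ 1 ≤ σ ∧ σ < 2 ∧
    ∀ u : U, clarkeDeriv J u (-u) ≤ ((d * (1 + ‖u‖ ^ σ) : ℝ) : EReal))

/-- `ρ` is a mollifier with parameter `ε`. -/
structure IsMollifier (ε : ℝ) (ρ : ℝ → ℝ) : Prop where
  smooth : ContDiff ℝ ∞ ρ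
  nonneg : ∀ x, 0 ≤ ρ x
  support_subset : Function.support ρ ⊆ Set.Icc (-ε) ε
  integral_eq_one : ∫ x, ρ x = 1

/-- The regularization
`f_ε(t) = ∫_0^T ρ_ε(t + ε (T - 2t) / T - s) f(s) ds` of `f ∈ L²(0,T;V*)`. -/
def mollify (T ε : ℝ) (ρ : ℝ → ℝ) (f : Lp (StrongDual ℝ V) 2 (timeMeasure T)) (t : ℝ) :
    StrongDual ℝ V :=
  ∫ s in Set.Ioo 0 T, ρ (t + ε * ((T - 2 * t) / T) - s) • f s

/-- Admissible discretization data: time steps `τ n → 0` with `T / τ n = N n` an integer, mollifiers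
`ρ n` with parameters `ε n → 0`, and approximations `u₀τ n ∈ V` of the initial value `u₀ ∈ H`. -/
structure IsDiscretization (i : V →L[ℝ] H) (T : ℝ) (u₀ : H) (τ : ℕ → ℝ) (N : ℕ → ℕ)
    (ε : ℕ → ℝ) (ρ : ℕ → ℝ → ℝ) (u₀τ : ℕ → V) : Prop where
  τ_pos : ∀ n, 0 < τ n
  τ_tendsto : Tendsto τ atTop (𝓝 0)
  N_eq : ∀ n, T / τ n = (N n : ℝ)
  ε_pos : ∀ n, 0 < ε n
  ε_tendsto : Tendsto ε atTop (𝓝 0)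
  mollifier : ∀ n, IsMollifier (ε n) (ρ n)
  init_tendsto : Tendsto (fun n => i (u₀τ n)) atTop (𝓝 u₀)
  init_bound : ∃ C : ℝ, 0 < C ∧ ∀ n, ‖u₀τ n‖ ≤ C / Real.sqrt (τ n)

/-- `u 0, …, u N` solves the implicit Euler scheme with time step `τ`, initial value `u₀τ` and
right-hand sides `fτ 1, …, fτ N`. -/
def IsRotheSolution (i : V →L[ℝ] H) (A : V → StrongDual ℝ V) (J : U → ℝ) (ι : V →L[ℝ] U)
    (τ : ℝ) (N : ℕ) (fτ : ℕ → StrongDual ℝ V) (u₀τ : V) (u : Fin (N + 1) → V) : Prop :=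
  u 0 = u₀τ ∧ ∀ k : Fin N, ∃ ξ ∈ clarkeSubdiff J (ι (u k.succ)), ∀ v : V,
    inner ℝ (τ⁻¹ • (i (u k.succ) - i (u k.castSucc))) (i v) + A (u k.succ) v + ξ (ι v)
      = fτ (k + 1) v

end EvolutionTriple

end Rothe

end

/-! The scheme is solved one step at a time: moving the old iterate to the right-hand side, `u^k`
solves `κ i*i u + A u + ι*∂J(ι u) ∋ g` with `κ = τ⁻¹`, so it suffices to solve this inclusion for
every `g` in `V*` once `τ` is small.

The inclusion is equivalent to a scalar inequality `Φ(u, v) ≥ 0` for all `v`, where `Φ` is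
`stepForm`, with Clarke's derivative in place of the multivalued term; Hahn-Banach
(`exists_mem_clarkeSubdiff`) recovers `ξ`. The function `Φ` is convex in `v`, zero on the diagonal
and upper semicontinuous in `u` on finite-dimensional subspaces, so Ky Fan's inequality
(`exists_forall_nonneg_of_convexOn`) gives Galerkin solutions. Testing with `v = 0` and using
coercivity (`HypAux.exists_coercive`) bounds them uniformly. A subsequence converges weakly in `V`
and, by compactness of `i` and `ι`, strongly in `H` and `U`; pseudomonotonicity of `A` then passes
`Φ ≥ 0` to the limit (`stepForm_nonneg_of_weakTendsto`).

Ky Fan's inequality comes from Brouwer's theorem for `C¹` maps applied to a smooth selection, and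
Brouwer's theorem from a volume-polynomial proof that the ball has no `C¹` retraction onto its
sphere. -/

noncomputable section

namespace Rothe

/-! ### Brouwer's fixed point theorem for `C¹` maps -/

/-- The value at `1` of the polynomial `t ↦ det (1 + t M)` is an affine combination, with weights
not depending on `M`, of its values at any `dim E + 1` given nodes. -/
lemma exists_weights_det_one_add {E : Type*} [NormedAddCommGroup E] [NormedSpace ℝ E]
    [FiniteDimensional ℝ E] (s : Finset ℝ) (hs : s.card = Module.finrank ℝ E + 1) :
    ∃ w : ℝ → ℝ, ∑ t ∈ s, w t = 1 ∧
      ∀ M : E →L[ℝ] E, ∑ t ∈ s, w t * (1 + t • M).det = (1 + M).det := by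
  have hne : s.Nonempty := by rw [← Finset.card_pos]; omega
  have hinj : Set.InjOn (id : ℝ → ℝ) s := Function.injective_id.injOn
  refine ⟨fun t => (Lagrange.basis s id t).eval 1, ?_, fun M => ?_⟩
  · have := congrArg (Polynomial.eval 1) (Lagrange.sum_basis hinj hne)
    simpa [Polynomial.eval_finsetSum] using this
  · set B := Module.finBasis ℝ E
    set A := LinearMap.toMatrix B B (M : E →ₗ[ℝ] E)
    -- `P = det (X A + 1)` has degree at most `dim E`, so `dim E + 1` nodes interpolate it exactly.
    set P : Polynomial ℝ :=
      ((Polynomial.X : Polynomial ℝ) • A.map Polynomial.C + (1 : Matrix _ _ ℝ).map Polynomial.C).det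
    have hP : ∀ t : ℝ, P.eval t = (1 + t • M).det := fun t => by
      have h1 : P.eval t = (t • A + 1).det := by
        rw [← Polynomial.coe_evalRingHom, RingHom.map_det]
        congr 1
        ext i j
        by_cases hij : i = j <;> simp [hij] <;> ring
      rw [h1, ContinuousLinearMap.det, ← LinearMap.det_toMatrix B]
      congr 1
      simp [A, add_comm, LinearMap.toMatrix_one]
    have hdeg : P.degree < s.card := by
      have h2 : P.natDegree ≤ Module.finrank ℝ E := by
        simpa only [Fintype.card_fin] using Polynomial.natDegree_det_X_add_C_le A 1
      rw [hs]
      exact lt_of_le_of_lt Polynomial.degree_le_natDegree (by exact_mod_cast Nat.lt_succ_of_le h2)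
    have h3 := congrArg (Polynomial.eval 1) (Lagrange.eq_interpolate hinj hdeg)
    rw [Lagrange.interpolate_apply, Polynomial.eval_finsetSum] at h3
    have h4 := hP 1
    rw [one_smul] at h4
    rw [← h4, h3]
    refine Finset.sum_congr rfl fun t _ => ?_
    simp [hP, mul_comm]

/-- A Lipschitz map on the closed unit ball that vanishes on the sphere stays Lipschitz when
extended by zero. -/
lemma lipschitzWith_indicator_closedBall {E : Type*} [NormedAddCommGroup E] [NormedSpace ℝ E]
    {K : ℝ≥0} {g : E → E} (hg : LipschitzOnWith K g (Metric.closedBall 0 1))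
    (h0 : ∀ x, ‖x‖ = 1 → g x = 0) :
    LipschitzWith K ((Metric.closedBall (0 : E) 1).indicator g) := by
  have key : ∀ x y : E, ‖x‖ ≤ 1 → 1 < ‖y‖ → ‖g x‖ ≤ K * ‖x - y‖ := fun x y hx hy => by
    -- The segment from `x` to `y` meets the sphere, where `g` vanishes, at distance at most `‖x -
    -- y‖` from `x`.
    have hc : ContinuousOn (fun t : ℝ => ‖x + t • (y - x)‖) (Set.Icc 0 1) := by fun_prop
    obtain ⟨t, ht, htx⟩ := intermediate_value_Icc zero_le_one hc
      (show (1 : ℝ) ∈ Set.Icc _ _ from ⟨by simpa using hx, by simpa using hy.le⟩)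
    have h1 := hg.dist_le_mul x (by simpa using hx) (x + t • (y - x)) (by simpa using htx.le)
    rw [h0 _ htx, dist_zero_right, dist_self_add_right, norm_smul, Real.norm_of_nonneg ht.1,
      norm_sub_rev y x] at h1
    refine h1.trans (mul_le_mul_of_nonneg_left ?_ K.2)
    exact mul_le_of_le_one_left (norm_nonneg _) ht.2
  refine LipschitzWith.of_dist_le_mul fun x y => ?_
  by_cases hx : x ∈ Metric.closedBall (0 : E) 1 <;> by_cases hy : y ∈ Metric.closedBall (0 : E) 1
  · rw [Set.indicator_of_mem hx, Set.indicator_of_mem hy]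
    exact hg.dist_le_mul x hx y hy
  · rw [Set.indicator_of_mem hx, Set.indicator_of_notMem hy, dist_zero_right, dist_eq_norm]
    exact key x y (by simpa using hx) (by simpa using hy)
  · rw [Set.indicator_of_notMem hx, Set.indicator_of_mem hy, dist_zero_left, dist_comm,
      dist_eq_norm]
    exact key y x (by simpa using hy) (by simpa using hx)
  · rw [Set.indicator_of_notMem hx, Set.indicator_of_notMem hy, dist_self]
    positivity

/-- A small perturbation of the identity of the closed unit ball by a convex combination with a
self-map fixing the sphere is a bijection of the ball. -/
lemma bijOn_closedBall_add_smul {E : Type*} [NormedAddCommGroup E] [NormedSpace ℝ E]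
    [CompleteSpace E] {K : ℝ≥0} {g : E → E} (hg : LipschitzOnWith K g (Metric.closedBall 0 1))
    (h0 : ∀ x, ‖x‖ = 1 → g x = 0) (h1 : ∀ x, ‖x‖ ≤ 1 → ‖x + g x‖ ≤ 1)
    {t : ℝ} (ht0 : 0 ≤ t) (ht1 : t ≤ 1) (htK : t * K < 1) :
    Set.BijOn (fun x => x + t • g x) (Metric.closedBall 0 1) (Metric.closedBall 0 1) := by
  refine ⟨fun x hx => ?_, fun x hx y hy hxy => ?_, fun y hy => ?_⟩
  · have := (convex_closedBall (0 : E) 1) hx (show x + g x ∈ _ by simpa using h1 x (by simpa using hx))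
      (sub_nonneg.2 ht1) ht0 (by ring)
    convert this using 1
    module
  · have h2 : x - y = t • (g y - g x) := by
      rw [smul_sub, sub_eq_sub_iff_add_eq_add]
      simpa [add_comm] using hxy
    have h3 : ‖x - y‖ ≤ t * K * ‖x - y‖ := by
      conv_lhs => rw [h2, norm_smul, Real.norm_of_nonneg ht0]
      rw [mul_assoc]
      refine mul_le_mul_of_nonneg_left ?_ ht0
      have := hg.dist_le_mul y hy x hx
      rwa [dist_eq_norm, dist_eq_norm, norm_sub_rev y x] at this
    have h4 : ‖x - y‖ = 0 := by
      by_contra h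
      have : 0 < ‖x - y‖ := lt_of_le_of_ne (norm_nonneg _) (Ne.symm h)
      nlinarith
    exact sub_eq_zero.1 (norm_eq_zero.1 h4)
  -- Preimages of `y` are fixed points of the contraction `x ↦ y - t G x`. A fixed point outside the
  -- ball would equal `y`, which lies inside.
  · set G := (Metric.closedBall (0 : E) 1).indicator g
    have hG := lipschitzWith_indicator_closedBall hg h0
    have hc : ContractingWith (t.toNNReal * K) (fun x => y - t • G x) := by
      refine ⟨by rwa [← NNReal.coe_lt_coe, NNReal.coe_mul, Real.coe_toNNReal _ ht0], LipschitzWith.of_dist_le_mul fun a b => ?_⟩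
      rw [dist_sub_left, dist_smul₀, Real.norm_of_nonneg ht0, NNReal.coe_mul,
        Real.coe_toNNReal _ ht0, mul_assoc]
      exact mul_le_mul_of_nonneg_left (hG.dist_le_mul a b) ht0
    obtain ⟨x, hx⟩ : ∃ x, y - t • G x = x := ⟨_, hc.fixedPoint_isFixedPt⟩
    by_cases hxB : x ∈ Metric.closedBall (0 : E) 1
    · refine ⟨x, hxB, ?_⟩
      have : G x = g x := Set.indicator_of_mem hxB g
      rw [this] at hx
      exact (eq_add_of_sub_eq hx).symm
    · have : G x = 0 := Set.indicator_of_notMem hxB g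
      rw [this, smul_zero, sub_zero] at hx
      exact absurd (hx ▸ hy) hxB

/-- There is no `C¹` retraction of the closed unit ball onto the sphere. -/
theorem no_retraction {E : Type*} [NormedAddCommGroup E] [InnerProductSpace ℝ E]
    [FiniteDimensional ℝ E] {r : E → E} {r' : E → E →L[ℝ] E}
    (hr : ∀ x, ‖x‖ ≤ 1 → HasFDerivAt r (r' x) x)
    (hr' : ContinuousOn r' (Metric.closedBall 0 1))
    (hnorm : ∀ x, ‖x‖ ≤ 1 → ‖r x‖ = 1) (hfix : ∀ x, ‖x‖ = 1 → r x = x) : False := by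
  borelize E
  set D := Metric.closedBall (0 : E) 1
  have hD : IsCompact D := isCompact_closedBall 0 1
  set M : E → E →L[ℝ] E := fun x => r' x - 1
  have hM : ContinuousOn M D := hr'.sub continuousOn_const
  have hg : ∀ x, ‖x‖ ≤ 1 → HasFDerivAt (fun x => r x - x) (M x) x :=
    fun x hx => (hr x hx).sub (hasFDerivAt_id x)
  obtain ⟨K, hK⟩ : ∃ K : ℝ≥0, ∀ x ∈ D, ‖M x‖ ≤ K := by
    obtain ⟨K, hK⟩ := hD.exists_bound_of_continuousOn hM
    exact ⟨K.toNNReal, fun x hx => (hK x hx).trans (Real.le_coe_toNNReal K)⟩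
  have hLip : LipschitzOnWith K (fun x => r x - x) D :=
    (convex_closedBall (0 : E) 1).lipschitzOnWith_of_nnnorm_hasFDerivWithin_le
      (fun x hx => (hg x (by simpa [D] using hx)).hasFDerivWithinAt) fun x hx => hK x hx
  obtain ⟨η, hη, hdet⟩ : ∃ η > 0, ∀ A : E →L[ℝ] E, ‖A‖ < η → 0 < (1 + A).det := by
    have hc : ContinuousAt (fun A : E →L[ℝ] E => (1 + A).det) 0 :=
      (ContinuousLinearMap.continuous_det.comp (continuous_const.add continuous_id)).continuousAt
    have h1 : ∀ᶠ A in 𝓝 (0 : E →L[ℝ] E), 0 < (1 + A).det := by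
      refine hc.eventually (lt_mem_nhds ?_)
      simp [ContinuousLinearMap.det]
    obtain ⟨η, hη, h⟩ := Metric.eventually_nhds_iff.1 h1
    exact ⟨η, hη, fun A hA => h (by simpa using hA)⟩
  have hK1 : (0 : ℝ) < K + 1 := by positivity
  -- The three bounds on `t` give, in turn, a convex combination, the contraction `t K < 1`, and a
  -- positive Jacobian of `x + t (r x - x)`.
  set δ : ℝ := min 1 (min (1 / (K + 1)) (η / (K + 1)))
  have hδ : 0 < δ := by positivity
  have hvol : ∀ t ∈ Set.Ioo 0 δ, ∫ x in D, (1 + t • M x).det = volume.real D := by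
    rintro t ⟨ht0, htδ⟩
    have ht1 : t ≤ 1 := htδ.le.trans (min_le_left _ _)
    have htK : t * (K + 1) < 1 := (lt_div_iff₀ hK1).1
      (htδ.trans_le ((min_le_right _ _).trans (min_le_left _ _)))
    have htη : t * (K + 1) < η := (lt_div_iff₀ hK1).1
      (htδ.trans_le ((min_le_right _ _).trans (min_le_right _ _)))
    have hbij := bijOn_closedBall_add_smul (t := t) hLip (fun x hx => by simp [hfix x hx])
      (fun x hx => by simp [hnorm x hx]) ht0.le ht1 (by nlinarith)
    have h2 := integral_image_eq_integral_abs_det_fderiv_smul volume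
      (measurableSet_closedBall (x := (0 : E)) (ε := 1))
      (f := fun x => x + t • (r x - x)) (f' := fun x => 1 + t • M x)
      (fun x hx => ((hasFDerivAt_id x).add
        ((hg x (by simpa using hx)).const_smul t)).hasFDerivWithinAt) hbij.injOn (fun _ => (1 : ℝ))
    rw [hbij.image_eq] at h2
    simp only [smul_eq_mul, mul_one, integral_const, MeasurableSet.univ, measureReal_restrict_apply,
      Set.univ_inter] at h2
    rw [h2]
    refine setIntegral_congr_fun measurableSet_closedBall fun x hx => (abs_of_pos (hdet _ ?_)).symm
    rw [norm_smul, Real.norm_of_nonneg ht0.le]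
    have := hK x hx
    nlinarith
  -- The integral of the Jacobian is a polynomial in `t`, equal to the volume of the ball for small
  -- `t`. Interpolation at small nodes carries this value to `t = 1`, where the map is `r`.
  obtain ⟨s, hsδ, hs⟩ : ∃ s : Finset ℝ, (s : Set ℝ) ⊆ Set.Ioo 0 δ ∧
      s.card = Module.finrank ℝ E + 1 :=
    (Set.Ioo_infinite hδ).exists_subset_card_eq _
  obtain ⟨w, hw1, hw⟩ := exists_weights_det_one_add s hs
  have hint : ∀ t ∈ s, Integrable (fun x => w t * (1 + t • M x).det) (volume.restrict D) :=
    fun t _ => (ContinuousOn.integrableOn_compact hD (continuousOn_const.mul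
      (ContinuousLinearMap.continuous_det.comp_continuousOn
        (continuousOn_const.add (hM.const_smul t)))))
  have h3 : ∫ x in D, (r' x).det = volume.real D := by
    calc ∫ x in D, (r' x).det = ∫ x in D, ∑ t ∈ s, w t * (1 + t • M x).det := by
          refine setIntegral_congr_fun measurableSet_closedBall fun x _ => ?_
          simp only [hw, M, add_sub_cancel]
      _ = ∑ t ∈ s, w t * volume.real D := by
          rw [integral_finsetSum _ hint]
          refine Finset.sum_congr rfl fun t ht => ?_
          rw [integral_const_mul, hvol t (hsδ ht)]
      _ = volume.real D := by rw [← Finset.sum_mul, hw1, one_mul]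
  -- Differentiating `‖r‖² = 1` shows that `r x` is orthogonal to the range of `r' x`; invertibility
  -- would put `r x` itself in that range.
  have h4 : ∀ x ∈ Metric.ball (0 : E) 1, (r' x).det = 0 := fun x hx => by
    have hx1 : ‖x‖ < 1 := by simpa using hx
    have h5 : HasFDerivAt (fun y => ‖r y‖ ^ 2) (2 • (innerSL ℝ (r x)).comp (r' x)) x :=
      (hr x hx1.le).norm_sq
    have h6 : HasFDerivAt (fun y => ‖r y‖ ^ 2) (0 : E →L[ℝ] ℝ) x := by
      refine (hasFDerivAt_const (1 : ℝ) x).congr_of_eventuallyEq ?_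
      filter_upwards [Metric.isOpen_ball.mem_nhds hx] with y hy
      rw [hnorm y (by simpa using (Metric.ball_subset_closedBall hy)), one_pow]
    have h7 := h5.unique h6
    by_contra hne
    obtain ⟨v, hv⟩ : ∃ v, r' x v = r x := by
      have h10 : IsUnit (r' x : E →ₗ[ℝ] E) :=
        (LinearMap.isUnit_iff_isUnit_det _).2 (isUnit_iff_ne_zero.2 hne)
      exact ((Module.End.isUnit_iff _).1 h10).surjective (r x)
    have h8 := DFunLike.congr_fun h7 v
    simp [hv, hnorm x hx1.le] at h8
  have h9 : ∫ x in D, (r' x).det = 0 := by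
    rw [integral_congr_ae (g := fun _ => (0 : ℝ)) ?_, integral_zero]
    have h10 : ∀ᵐ x : E, x ∉ Metric.sphere (0 : E) 1 :=
      measure_eq_zero_iff_ae_notMem.1 (Measure.addHaar_sphere_of_ne_zero _ _ one_ne_zero)
    rw [EventuallyEq, ae_restrict_iff' measurableSet_closedBall]
    filter_upwards [h10] with x hx hxD
    refine h4 x (mem_ball_zero_iff.2 (lt_of_le_of_ne (mem_closedBall_zero_iff.1 hxD) ?_))
    simpa using hx
  have h10 : 0 < volume.real D :=
    ENNReal.toReal_pos (Metric.measure_closedBall_pos _ _ one_pos).ne' hD.measure_lt_top.ne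
  linarith

/-- Brouwer's fixed point theorem for `C¹` maps into the closed unit ball. -/
theorem exists_fixedPoint_of_contDiff {E : Type*} [NormedAddCommGroup E] [InnerProductSpace ℝ E]
    [FiniteDimensional ℝ E] {p : E → E} (hp : ContDiff ℝ 1 p) (hp1 : ∀ x, ‖p x‖ ≤ 1) :
    ∃ x, ‖x‖ ≤ 1 ∧ p x = x := by
  by_contra! hne
  set d : E → E := fun x => x - p x
  set b : E → ℝ := fun x => inner ℝ x (d x)
  set q : E → ℝ := fun x => b x ^ 2 + ‖d x‖ ^ 2 * (1 - ‖x‖ ^ 2)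
  -- The ray from `p x` through `x` hits the sphere at `x + l d`, with `l` the larger root of `‖d‖²
  -- l² + 2 b l + ‖x‖² - 1 = 0`; `q` is a quarter of its discriminant. On the sphere `b > 0`, so `l
  -- = 0`.
  set r : E → E := fun x => x + ((-b x + √(q x)) / ‖d x‖ ^ 2) • d x
  have hd : ContDiff ℝ 1 d := contDiff_id.sub hp
  have hb : ContDiff ℝ 1 b := contDiff_id.inner ℝ hd
  have hq : ContDiff ℝ 1 q :=
    (hb.pow 2).add ((hd.norm_sq ℝ).mul (contDiff_const.sub (contDiff_id.norm_sq ℝ)))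
  have hd0 : ∀ x, ‖x‖ ≤ 1 → 0 < ‖d x‖ := fun x hx =>
    norm_pos_iff.2 (sub_ne_zero.2 (hne x hx).symm)
  have hb0 : ∀ x, ‖x‖ = 1 → 0 < b x := fun x hx => by
    have h1 : ‖d x‖ ^ 2 = ‖x‖ ^ 2 - 2 * inner ℝ x (p x) + ‖p x‖ ^ 2 := norm_sub_sq_real x (p x)
    have h2 : b x = ‖x‖ ^ 2 - inner ℝ x (p x) := by
      simp only [b, d, inner_sub_right, real_inner_self_eq_norm_sq]
    have h3 := hd0 x hx.le
    have h4 := hp1 x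
    rw [hx] at h1 h2
    nlinarith [norm_nonneg (p x)]
  have hq0 : ∀ x, ‖x‖ ≤ 1 → 0 < q x := fun x hx => by
    rcases hx.eq_or_lt with h | h
    · have := hb0 x h
      simp only [q, h]
      nlinarith
    · have := hd0 x hx
      have h2 : 0 < 1 - ‖x‖ ^ 2 := by nlinarith [norm_nonneg x]
      positivity
  set O : Set E := {x | d x ≠ 0} ∩ {x | 0 < q x}
  have hO : IsOpen O :=
    (isOpen_ne.preimage hd.continuous).inter (isOpen_lt continuous_const hq.continuous)
  have hBO : Metric.closedBall (0 : E) 1 ⊆ O := fun x hx => by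
    rw [mem_closedBall_zero_iff] at hx
    exact ⟨norm_pos_iff.1 (hd0 x hx), hq0 x hx⟩
  have hr : ContDiffOn ℝ 1 r O := by
    refine contDiffOn_id.add (ContDiffOn.smul (ContDiffOn.div ?_ ?_ ?_) hd.contDiffOn)
    · exact hb.neg.contDiffOn.add (hq.contDiffOn.sqrt fun x hx => (ne_of_gt hx.2))
    · exact (hd.norm_sq ℝ).contDiffOn
    · exact fun x hx => pow_ne_zero 2 (norm_ne_zero_iff.2 hx.1)
  refine no_retraction (r := r) (r' := fderiv ℝ r) (fun x hx => ?_)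
    ((hr.continuousOn_fderiv_of_isOpen hO le_rfl).mono hBO) (fun x hx => ?_) (fun x hx => ?_)
  · exact ((hr.contDiffAt (hO.mem_nhds (hBO (by simpa using hx)))).differentiableAt
      one_ne_zero).hasFDerivAt
  · have h1 := (hd0 x hx).ne'
    have h2 : √(q x) ^ 2 = b x ^ 2 + ‖d x‖ ^ 2 * (1 - ‖x‖ ^ 2) := Real.sq_sqrt (hq0 x hx).le
    have h3 : ‖r x‖ ^ 2 = 1 := by
      simp only [r]
      rw [norm_add_sq_real, inner_smul_right, norm_smul, mul_pow, Real.norm_eq_abs, sq_abs]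
      change ‖x‖ ^ 2 + 2 * (_ * b x) + _ = 1
      field_simp
      linear_combination h2
    exact (pow_eq_one_iff_of_nonneg (norm_nonneg _) two_ne_zero).1 h3
  · have : √(q x) = b x := by
      simp only [q, hx]
      rw [one_pow, sub_self, mul_zero, add_zero, Real.sqrt_sq (hb0 x hx).le]
    simp [r, this]

/-! ### Ky Fan's inequality -/

/-- Ky Fan's inequality on a finite-dimensional space, with a coercivity condition in place of
compactness. -/
theorem exists_forall_nonneg_of_convexOn {F : Type*} [NormedAddCommGroup F] [NormedSpace ℝ F]
    [FiniteDimensional ℝ F] {Φ : F → F → ℝ} (husc : ∀ v, UpperSemicontinuous fun u => Φ u v)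
    (hconv : ∀ u, ConvexOn ℝ Set.univ (Φ u)) (hdiag : ∀ u, Φ u u = 0) {R : ℝ}
    (hR : ∀ u, 0 ≤ Φ u 0 → ‖u‖ < R) : ∃ u, ‖u‖ < R ∧ ∀ v, 0 ≤ Φ u v := by
  have hR0 : 0 < R := by simpa using hR 0 (hdiag 0).ge
  set e := toEuclidean (E := F)
  -- With this scaling, the image under `L` of the Euclidean unit ball contains the ball of radius
  -- `R` in `F`.
  set ρ : ℝ := ‖(e : F →L[ℝ] EuclideanSpace ℝ (Fin (Module.finrank ℝ F)))‖ * R + 1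
  have hρ : 0 < ρ := by positivity
  set L : EuclideanSpace ℝ (Fin (Module.finrank ℝ F)) → F := fun x => e.symm (ρ • x)
  have hL : Continuous L := e.symm.continuous.comp (continuous_const_smul ρ)
  have hLe : ∀ u : F, L (ρ⁻¹ • e u) = u := fun u => by simp [L, smul_smul, hρ.ne']
  obtain ⟨x, hx, hxv⟩ : ∃ x, ‖x‖ ≤ 1 ∧ ∀ y, ‖y‖ ≤ 1 → 0 ≤ Φ (L x) (L y) := by
    by_contra! hno
    set t : EuclideanSpace ℝ (Fin (Module.finrank ℝ F)) → Set (EuclideanSpace ℝ _) :=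
      fun x => {y | ‖y‖ ≤ 1 ∧ (‖x‖ ≤ 1 → Φ (L x) (L y) < 0)}
    have ht : ∀ x, Convex ℝ (t x) := fun x y hy z hz a b ha hb hab => by
      refine ⟨?_, fun hx => ?_⟩
      · simpa using (convex_closedBall (0 : EuclideanSpace ℝ (Fin (Module.finrank ℝ F))) 1)
          (by simpa using hy.1) (by simpa using hz.1) ha hb hab
      · have h1 := (hconv (L x)).2 (Set.mem_univ (L y)) (Set.mem_univ (L z)) ha hb hab
        have h2 : L (a • y + b • z) = a • L y + b • L z := by
          simp only [L, smul_add, map_add, map_smul, smul_comm ρ]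
        rw [h2]
        have h3 := hy.2 hx
        have h4 := hz.2 hx
        simp only [smul_eq_mul] at h1
        rcases ha.eq_or_lt with h | h
        · rw [← h] at h1 hab
          rw [zero_add] at hab
          rw [← h]
          rw [hab] at h1 ⊢
          linarith
        · nlinarith
    obtain ⟨g, hg⟩ := exists_contMDiffMap_forall_mem_convex_of_local_const
      (n := 1) (modelWithCornersSelf ℝ (EuclideanSpace ℝ (Fin (Module.finrank ℝ F)))) ht
      fun x => by
        by_cases hx : ‖x‖ ≤ 1
        · obtain ⟨y, hy, hxy⟩ := hno x hx
          refine ⟨y, ?_⟩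
          filter_upwards [((husc (L y)).comp hL) x 0 hxy] with z hz
          exact ⟨hy, fun _ => hz⟩
        · refine ⟨0, ?_⟩
          filter_upwards [(isOpen_lt continuous_const continuous_norm).mem_nhds
            (not_le.1 hx)] with z hz
          exact ⟨by simp, fun h => absurd h (not_le.2 hz)⟩
    obtain ⟨x, hx, hgx⟩ := exists_fixedPoint_of_contDiff g.contMDiff.contDiff fun x => (hg x).1
    have := (hg x).2 hx
    rw [hgx, hdiag] at this
    exact lt_irrefl _ this
  have hu : ‖L x‖ < R := hR _ (by simpa [L] using hxv 0 (by simp))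
  refine ⟨L x, hu, fun v => ?_⟩
  -- Since `‖L x‖ < R` strictly, a short step towards any `v` stays admissible, and convexity with
  -- `Φ(u, u) = 0` gives `Φ(u, u + s (v - u)) ≤ s Φ(u, v)`.
  have hseg : ∀ᶠ s : ℝ in 𝓝[>] 0, ‖L x + s • (v - L x)‖ < R := by
    refine Tendsto.eventually_lt_const hu ?_
    refine tendsto_nhdsWithin_of_tendsto_nhds (Continuous.tendsto' (by fun_prop) _ _ (by simp))
  obtain ⟨s, hs, hs1⟩ := (hseg.and (Ioo_mem_nhdsGT zero_lt_one)).exists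
  have h1 := hxv (ρ⁻¹ • e (L x + s • (v - L x))) (by
    rw [norm_smul, norm_inv, Real.norm_of_nonneg hρ.le, inv_mul_le_iff₀ hρ, mul_one]
    refine ((e : F →L[ℝ] EuclideanSpace ℝ (Fin (Module.finrank ℝ F))).le_opNorm _).trans ?_
    have := mul_le_mul_of_nonneg_left hs.le (norm_nonneg (e : F →L[ℝ] EuclideanSpace ℝ (Fin (Module.finrank ℝ F))))
    linarith)
  rw [hLe] at h1
  have h2 := (hconv (L x)).2 (Set.mem_univ (L x)) (Set.mem_univ v) (sub_nonneg.2 hs1.2.le) hs1.1.le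
    (by ring)
  have h3 : (1 - s) • L x + s • v = L x + s • (v - L x) := by module
  rw [h3, hdiag, smul_zero, zero_add, smul_eq_mul] at h2
  exact nonneg_of_mul_nonneg_right (h1.trans h2) hs1.1

/-! ### Calculus of Clarke's derivative -/

lemma eventually_snd_pos {X : Type*} [TopologicalSpace X] (x : X) :
    ∀ᶠ q : X × ℝ in 𝓝 x ×ˢ 𝓝[>] (0 : ℝ), 0 < q.2 :=
  tendsto_snd.eventually (self_mem_nhdsWithin (s := Set.Ioi (0 : ℝ)))

section Clarke

variable {X : Type*} [NormedAddCommGroup X] [NormedSpace ℝ X] {j : X → ℝ}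

/-- The difference quotients whose superior limit is Clarke's derivative. -/
def clarkeQuot (j : X → ℝ) (z : X) (q : X × ℝ) : ℝ := (j (q.1 + q.2 • z) - j q.1) / q.2

/-- Clarke's derivative as a real number. -/
def clarkeReal (j : X → ℝ) (x z : X) : ℝ := (clarkeDeriv j x z).toReal

lemma eventually_add_smul {x : X} (z : X) {s : Set X} (hs : s ∈ 𝓝 x) :
    ∀ᶠ q : X × ℝ in 𝓝 x ×ˢ 𝓝[>] (0 : ℝ), q.1 + q.2 • z ∈ s := by
  have h : Tendsto (fun q : X × ℝ => q.1 + q.2 • z) (𝓝 x ×ˢ 𝓝 (0 : ℝ)) (𝓝 x) := by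
    rw [← nhds_prod_eq]
    exact Continuous.tendsto' (by fun_prop) _ _ (by simp)
  exact (h.mono_left (prod_mono le_rfl nhdsWithin_le_nhds)) hs

/-- A local Lipschitz constant at `x` serves all nearby base points and all directions at once. This
uniformity later yields joint upper semicontinuity. -/
lemma LocallyLipschitz.eventually_abs_clarkeQuot_le (hj : LocallyLipschitz j) (x : X) :
    ∃ K : ℝ≥0, ∀ᶠ y in 𝓝 x, ∀ z, ∀ᶠ q in 𝓝 y ×ˢ 𝓝[>] (0 : ℝ), |clarkeQuot j z q| ≤ K * ‖z‖ := by
  obtain ⟨K, s, hs, hK⟩ := hj x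
  refine ⟨K, ?_⟩
  filter_upwards [eventually_mem_nhds_iff.2 hs] with y hy z
  filter_upwards [eventually_add_smul z hy, eventually_snd_pos y,
    tendsto_fst.eventually hy] with q h1 h2 h3
  have h4 := hK.dist_le_mul _ h1 _ h3
  rw [Real.dist_eq, dist_self_add_left, norm_smul, Real.norm_of_nonneg h2.le] at h4
  rw [clarkeQuot, abs_div, abs_of_pos h2, div_le_iff₀ h2]
  linarith

lemma clarkeDeriv_le {x z : X} {a : ℝ}
    (h : ∀ᶠ q in 𝓝 x ×ˢ 𝓝[>] (0 : ℝ), clarkeQuot j z q ≤ a) : clarkeDeriv j x z ≤ a :=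
  limsup_le_of_le (h := h.mono fun _ hq => EReal.coe_le_coe_iff.2 hq)

lemma coe_clarkeReal (hj : LocallyLipschitz j) (x z : X) :
    (clarkeReal j x z : EReal) = clarkeDeriv j x z := by
  obtain ⟨K, hK⟩ := LocallyLipschitz.eventually_abs_clarkeQuot_le hj x
  have h := hK.self_of_nhds z
  have h1 : clarkeDeriv j x z ≤ ((K * ‖z‖ : ℝ) : EReal) :=
    clarkeDeriv_le (h.mono fun q hq => (abs_le.1 hq).2)
  have h2 : ((-(K * ‖z‖) : ℝ) : EReal) ≤ clarkeDeriv j x z :=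
    le_limsup_of_frequently_le'
      (h.mono fun q hq => EReal.coe_le_coe_iff.2 (abs_le.1 hq).1).frequently
  exact EReal.coe_toReal (ne_top_of_le_ne_top (EReal.coe_ne_top _) h1)
    (ne_bot_of_le_ne_bot (EReal.coe_ne_bot _) h2)

lemma clarkeReal_le (hj : LocallyLipschitz j) {x z : X} {a : ℝ}
    (h : ∀ᶠ q in 𝓝 x ×ˢ 𝓝[>] (0 : ℝ), clarkeQuot j z q ≤ a) : clarkeReal j x z ≤ a := by
  rw [← EReal.coe_le_coe_iff, coe_clarkeReal hj]
  exact clarkeDeriv_le h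

lemma eventually_clarkeQuot_lt (hj : LocallyLipschitz j) {x z : X} {a : ℝ}
    (h : clarkeReal j x z < a) : ∀ᶠ q in 𝓝 x ×ˢ 𝓝[>] (0 : ℝ), clarkeQuot j z q < a := by
  rw [← EReal.coe_lt_coe_iff, coe_clarkeReal hj] at h
  exact (eventually_lt_of_limsup_lt h).mono fun q hq => EReal.coe_lt_coe_iff.1 hq

/-- The quotient in direction `z + w` splits at the intermediate point `y + t w`, which also tends
to `x`; the base point in Clarke's limsup being free, both parts are controlled. -/
lemma clarkeReal_add_le (hj : LocallyLipschitz j) (x z w : X) :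
    clarkeReal j x (z + w) ≤ clarkeReal j x z + clarkeReal j x w := by
  refine le_of_forall_pos_le_add fun ε hε => clarkeReal_le hj ?_
  have h1 := eventually_clarkeQuot_lt hj (lt_add_of_pos_right (clarkeReal j x z) (half_pos hε))
  have h2 := eventually_clarkeQuot_lt hj (lt_add_of_pos_right (clarkeReal j x w) (half_pos hε))
  have h3 : Tendsto (fun q : X × ℝ => (q.1 + q.2 • w, q.2)) (𝓝 x ×ˢ 𝓝[>] (0 : ℝ))
      (𝓝 x ×ˢ 𝓝[>] (0 : ℝ)) :=
    Tendsto.prodMk (fun s hs => eventually_add_smul w hs) tendsto_snd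
  filter_upwards [h3.eventually h1, h2] with q hq1 hq2
  have h4 : clarkeQuot j (z + w) q
      = clarkeQuot j z (q.1 + q.2 • w, q.2) + clarkeQuot j w q := by
    simp only [clarkeQuot]
    rw [← add_div, show q.1 + q.2 • (z + w) = q.1 + q.2 • w + q.2 • z by module]
    ring
  linarith

lemma clarkeReal_smul_le (hj : LocallyLipschitz j) (x z : X) {r : ℝ} (hr : 0 < r) :
    clarkeReal j x (r • z) ≤ r * clarkeReal j x z := by
  refine le_of_forall_pos_le_add fun ε hε => clarkeReal_le hj ?_
  have h1 := eventually_clarkeQuot_lt hj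
    (lt_add_of_pos_right (clarkeReal j x z) (div_pos hε hr))
  have h2 : Tendsto (fun t : ℝ => t * r) (𝓝[>] 0) (𝓝[>] 0) := by
    refine tendsto_nhdsWithin_iff.2 ⟨?_, ?_⟩
    · exact tendsto_nhdsWithin_of_tendsto_nhds (Continuous.tendsto' (by fun_prop) _ _ (by simp))
    · filter_upwards [self_mem_nhdsWithin] with t ht
      exact mul_pos ht hr
  have h3 : Tendsto (fun q : X × ℝ => (q.1, q.2 * r)) (𝓝 x ×ˢ 𝓝[>] (0 : ℝ))
      (𝓝 x ×ˢ 𝓝[>] (0 : ℝ)) := tendsto_id.prodMap h2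
  filter_upwards [h3.eventually h1, eventually_snd_pos x] with q hq hq0
  have h4 : clarkeQuot j (r • z) q = r * clarkeQuot j z (q.1, q.2 * r) := by
    simp only [clarkeQuot, smul_smul]
    field_simp
  rw [h4]
  calc r * clarkeQuot j z (q.1, q.2 * r) ≤ r * (clarkeReal j x z + ε / r) :=
        mul_le_mul_of_nonneg_left hq.le hr.le
    _ = _ := by field_simp

lemma clarkeReal_smul (hj : LocallyLipschitz j) (x z : X) {r : ℝ} (hr : 0 < r) :
    clarkeReal j x (r • z) = r * clarkeReal j x z := by
  refine le_antisymm (clarkeReal_smul_le hj x z hr) ?_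
  have := clarkeReal_smul_le hj x (r • z) (inv_pos.2 hr)
  rw [smul_smul, inv_mul_cancel₀ hr.ne', one_smul] at this
  rwa [← le_inv_mul_iff₀ hr]

@[simp] lemma clarkeReal_zero (hj : LocallyLipschitz j) (x : X) : clarkeReal j x 0 = 0 := by
  have := clarkeReal_smul hj x 0 two_pos
  rw [smul_zero] at this
  linarith

lemma convexOn_clarkeReal (hj : LocallyLipschitz j) (x : X) :
    ConvexOn ℝ Set.univ (clarkeReal j x) := by
  refine ⟨convex_univ, fun z _ w _ a b ha hb hab => ?_⟩
  rcases ha.eq_or_lt with rfl | ha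
  · rw [zero_add] at hab
    simp [hab]
  rcases hb.eq_or_lt with rfl | hb
  · rw [add_zero] at hab
    simp [hab]
  refine (clarkeReal_add_le hj x _ _).trans ?_
  rw [clarkeReal_smul hj x z ha, clarkeReal_smul hj x w hb, smul_eq_mul, smul_eq_mul]

lemma neg_clarkeReal_neg_le (hj : LocallyLipschitz j) (x z : X) :
    -clarkeReal j x (-z) ≤ clarkeReal j x z := by
  have := clarkeReal_add_le hj x z (-z)
  rw [add_neg_cancel, clarkeReal_zero hj] at this
  linarith

lemma LocallyLipschitz.eventually_clarkeReal_le (hj : LocallyLipschitz j) (x : X) :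
    ∃ K : ℝ≥0, ∀ᶠ y in 𝓝 x, ∀ z, clarkeReal j y z ≤ K * ‖z‖ := by
  obtain ⟨K, hK⟩ := LocallyLipschitz.eventually_abs_clarkeQuot_le hj x
  exact ⟨K, hK.mono fun y hy z => clarkeReal_le hj ((hy z).mono fun q hq => (abs_le.1 hq).2)⟩

/-- Clarke's derivative is upper semicontinuous jointly in the point and the direction. -/
lemma upperSemicontinuous_clarkeReal (hj : LocallyLipschitz j) :
    UpperSemicontinuous fun p : X × X => clarkeReal j p.1 p.2 := by
  rintro ⟨x, z⟩ a ha
  obtain ⟨a', ha', haa⟩ := exists_between ha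
  obtain ⟨K, hK⟩ := LocallyLipschitz.eventually_clarkeReal_le hj x
  have h1 : ∀ᶠ y in 𝓝 x, clarkeReal j y z ≤ a' := by
    obtain ⟨P, hP, Q, hQ, hPQ⟩ := eventually_prod_iff.1 (eventually_clarkeQuot_lt hj ha')
    filter_upwards [eventually_eventually_nhds.2 hP] with y hy
    refine clarkeReal_le hj ?_
    filter_upwards [hy.prod_mk hQ] with q hq
    exact (hPQ hq.1 hq.2).le
  have h2 : ∀ᶠ w in 𝓝 z, a' + K * ‖w - z‖ < a :=
    Tendsto.eventually_lt_const haa (Continuous.tendsto' (by fun_prop) _ _ (by simp))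
  rw [nhds_prod_eq]
  filter_upwards [(h1.and hK).prod_mk h2] with p hp
  have h3 := clarkeReal_add_le hj p.1 z (p.2 - z)
  rw [add_sub_cancel] at h3
  have h4 := hp.1.2 (p.2 - z)
  linarith [hp.1.1, hp.2]

lemma UpperSemicontinuous.clarkeReal_comp (hj : LocallyLipschitz j) {Y : Type*}
    [TopologicalSpace Y] {p z : Y → X} (hp : Continuous p) (hz : Continuous z) :
    UpperSemicontinuous fun y => clarkeReal j (p y) (z y) :=
  fun y _ ha => ((hp.prodMk hz).tendsto y).eventually (upperSemicontinuous_clarkeReal hj _ _ ha)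

/-- A linear functional dominated by Clarke's derivative along a linear map extends to an element of
Clarke's gradient. -/
lemma exists_mem_clarkeSubdiff (hj : LocallyLipschitz j) (x : X) {W : Type*} [AddCommGroup W]
    [Module ℝ W] (L : W →ₗ[ℝ] X) (φ : W →ₗ[ℝ] ℝ) (hφ : ∀ w, φ w ≤ clarkeReal j x (L w)) :
    ∃ ξ ∈ clarkeSubdiff j x, ∀ w, ξ (L w) = φ w := by
  -- Domination by `clarkeReal` makes `φ` vanish on the kernel of `L`, so it factors through the
  -- range, where Hahn-Banach applies.
  have hker : φ ∈ (LinearMap.ker L).dualAnnihilator := by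
    rw [Submodule.mem_dualAnnihilator]
    intro w hw
    have h1 := hφ w
    have h2 := hφ (-w)
    rw [LinearMap.mem_ker] at hw
    rw [map_neg, map_neg, hw, neg_zero, clarkeReal_zero hj] at h2
    rw [hw, clarkeReal_zero hj] at h1
    linarith
  rw [← LinearMap.range_dualMap_eq_dualAnnihilator_ker] at hker
  obtain ⟨ψ, rfl⟩ := hker
  obtain ⟨g, hg1, hg2⟩ := exists_extension_of_le_sublinear
    ⟨LinearMap.range L, ψ.domRestrict (LinearMap.range L)⟩ (clarkeReal j x)
    (fun r hr z => clarkeReal_smul hj x z hr) (clarkeReal_add_le hj x) (by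
      rintro ⟨_, w, rfl⟩
      exact hφ w)
  obtain ⟨K, hK⟩ := LocallyLipschitz.eventually_clarkeReal_le hj x
  have hK := hK.self_of_nhds
  refine ⟨g.mkContinuous K fun z => ?_, fun z => ?_, fun w => ?_⟩
  · rw [Real.norm_eq_abs, abs_le]
    have h1 := (hg2 (-z)).trans (hK (-z))
    rw [map_neg, norm_neg] at h1
    exact ⟨by linarith, (hg2 z).trans (hK z)⟩
  · rw [← coe_clarkeReal hj, EReal.coe_le_coe_iff]
    exact hg2 z
  · exact hg1 ⟨L w, w, rfl⟩

/-- Hahn-Banach from the line through `z` produces a subgradient attaining the derivative in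
direction `z`; the growth bound on subgradients then applies. -/
lemma HypJ.clarkeReal_le {c : ℝ} (hJ : HypJ j c) (x z : X) :
    clarkeReal j x z ≤ c * (1 + ‖x‖) * ‖z‖ := by
  have hj := hJ.locallyLipschitz
  obtain ⟨ξ, hξ, hξz⟩ := exists_mem_clarkeSubdiff hj x (LinearMap.toSpanSingleton ℝ X z)
    (LinearMap.toSpanSingleton ℝ ℝ (clarkeReal j x z)) fun t => by
      simp only [LinearMap.toSpanSingleton_apply, smul_eq_mul]
      rcases lt_trichotomy t 0 with ht | rfl | ht
      · have h1 := neg_clarkeReal_neg_le hj x (t • z)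
        rw [← neg_smul, clarkeReal_smul hj x z (neg_pos.2 ht)] at h1
        linarith
      · simp [hj]
      · rw [clarkeReal_smul hj x z ht]
  have h1 := hξz 1
  simp only [LinearMap.toSpanSingleton_apply, one_smul] at h1
  rw [← h1]
  refine (le_abs_self _).trans ((ξ.le_opNorm z).trans ?_)
  exact mul_le_mul_of_nonneg_right (hJ.growth x ξ hξ) (norm_nonneg z)

end Clarke

/-! ### Weak sequential compactness -/

section Weak

variable {X : Type*} [NormedAddCommGroup X] [NormedSpace ℝ X]

lemma weakTendsto_iff {x : ℕ → X} {x₀ : X} :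
    WeakTendsto x x₀ ↔ ∀ φ : StrongDual ℝ X, Tendsto (fun n => φ (x n)) atTop (𝓝 (φ x₀)) :=
  WeakBilin.tendsto_iff_forall_eval_tendsto _
    fun _ _ h => (SeparatingDual.eq_iff_forall_dual_eq (R := ℝ)).2 fun φ => DFunLike.congr_fun h φ

/-- A separable normed space has a sequence of functionals separating its points. -/
lemma exists_seq_separating [TopologicalSpace.SeparableSpace X] :
    ∃ φ : ℕ → StrongDual ℝ X, ∀ x, (∀ n, φ n x = 0) → x = 0 := by
  choose φ hφ1 hφ2 using fun n => exists_dual_vector'' ℝ (TopologicalSpace.denseSeq X n)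
  refine ⟨φ, fun x hx => norm_le_zero_iff.1 (le_of_forall_pos_le_add fun ε hε => ?_)⟩
  obtain ⟨_, ⟨n, rfl⟩, hn⟩ := Metric.mem_closure_iff.1
    ((TopologicalSpace.denseRange_denseSeq X).closure_eq ▸ Set.mem_univ x) (ε / 2) (half_pos hε)
  set e := TopologicalSpace.denseSeq X n
  rw [dist_eq_norm] at hn
  have h1 : ‖e‖ ≤ ‖x - e‖ := by
    have h2 : φ n (e - x) = ‖e‖ := by simp [map_sub, hφ2, hx, e]
    rw [← h2, norm_sub_rev]
    refine (le_abs_self _).trans (((φ n).le_opNorm _).trans ?_)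
    exact mul_le_of_le_one_left (norm_nonneg _) (hφ1 n)
  have h3 : ‖x‖ ≤ ‖x - e‖ + ‖e‖ := by simpa using norm_add_le (x - e) e
  linarith

/-- Bounded sequences in a separable reflexive space have weakly convergent subsequences. -/
theorem IsReflexiveSpace.exists_weakTendsto_subseq [TopologicalSpace.SeparableSpace X]
    (hX : IsReflexiveSpace X) {x : ℕ → X} {R : ℝ} (hx : ∀ n, ‖x n‖ ≤ R) :
    ∃ (x₀ : X) (θ : ℕ → ℕ), StrictMono θ ∧ WeakTendsto (x ∘ θ) x₀ := by
  obtain ⟨φ, hφ⟩ := exists_seq_separating (X := X)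
  have hc : IsCompact (Set.univ.pi fun n => Metric.closedBall (0 : ℝ) (‖φ n‖ * R)) :=
    isCompact_univ_pi fun n => isCompact_closedBall _ _
  obtain ⟨ℓ, -, θ, hθ, hℓ⟩ := hc.tendsto_subseq (x := fun k n => φ n (x k)) fun k n _ => by
    rw [mem_closedBall_zero_iff]
    exact ((φ n).le_opNorm _).trans (mul_le_mul_of_nonneg_left (hx k) (norm_nonneg _))
  rw [tendsto_pi_nhds] at hℓ
  -- Banach-Alaoglu in the bidual and reflexivity give a weak limit along every ultrafilter. Along
  -- `θ` each `φ n` converges, so the limits agree on a separating family and coincide.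
  have key : ∀ F : Ultrafilter ℕ, (F : Filter ℕ) ≤ atTop → ∃ y : X,
      ∀ ψ : StrongDual ℝ X, Tendsto (fun k => ψ (x (θ k))) F (𝓝 (ψ y)) := fun F hF => by
    have hB := WeakDual.isCompact_closedBall (0 : StrongDual ℝ (StrongDual ℝ X)) R
    set g : ℕ → WeakDual ℝ (StrongDual ℝ X) := fun k =>
      StrongDual.toWeakDual (NormedSpace.inclusionInDoubleDual ℝ X (x (θ k)))
    have hg : ∀ k, g k ∈ WeakDual.toStrongDual ⁻¹'
        Metric.closedBall (0 : StrongDual ℝ (StrongDual ℝ X)) R := fun k => by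
      refine (mem_closedBall_zero_iff (E := StrongDual ℝ (StrongDual ℝ X))).2 ?_
      exact (NormedSpace.double_dual_bound ℝ X _).trans (hx _)
    obtain ⟨η, -, hη⟩ := hB.ultrafilter_le_nhds' (F.map g) (Ultrafilter.mem_map.2 (Filter.univ_mem' hg))
    obtain ⟨y, hy⟩ := hX (WeakDual.toStrongDual η)
    refine ⟨y, fun ψ => ?_⟩
    have h1 : Tendsto g F (𝓝 η) := hη
    have h2 := ((WeakDual.eval_continuous ψ).tendsto η).comp h1
    have h3 : η ψ = ψ y := by
      rw [← NormedSpace.dual_def ℝ X y ψ, hy]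
      rfl
    rw [h3] at h2
    exact h2
  obtain ⟨y, hy⟩ := key (Ultrafilter.of atTop) (Ultrafilter.of_le _)
  refine ⟨y, θ, hθ, weakTendsto_iff.2 fun ψ => ?_⟩
  rw [tendsto_iff_ultrafilter]
  intro F hF
  obtain ⟨y', hy'⟩ := key F hF
  have : y' = y := by
    refine sub_eq_zero.1 (hφ _ fun n => ?_)
    rw [map_sub, sub_eq_zero,
      tendsto_nhds_unique (hy' (φ n)) ((hℓ n).mono_left hF),
      tendsto_nhds_unique (hy (φ n)) ((hℓ n).mono_left (Ultrafilter.of_le _))]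
  exact this ▸ hy' ψ

/-- A compact operator maps a bounded weakly convergent sequence to one with a strongly convergent
subsequence. -/
lemma exists_tendsto_subseq_of_isCompactOperator {Y : Type*} [NormedAddCommGroup Y]
    [NormedSpace ℝ Y] {L : X →L[ℝ] Y} (hL : IsCompactOperator L) {x : ℕ → X} {x₀ : X} {R : ℝ}
    (hx : ∀ n, ‖x n‖ ≤ R) (hw : WeakTendsto x x₀) :
    ∃ θ : ℕ → ℕ, StrictMono θ ∧ Tendsto (fun n => L (x (θ n))) atTop (𝓝 (L x₀)) := by
  obtain ⟨K, hK, hLK⟩ := hL.image_closedBall_subset_compact (f := (L : X →ₗ[ℝ] Y)) R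
  obtain ⟨y, -, θ, hθ, hy⟩ := hK.tendsto_subseq (x := fun n => L (x n)) fun n =>
    hLK ⟨x n, by simpa using hx n, rfl⟩
  have : y = L x₀ := by
    refine (SeparatingDual.eq_iff_forall_dual_eq (R := ℝ)).2 fun φ => ?_
    exact tendsto_nhds_unique ((φ.continuous.tendsto y).comp hy)
      ((weakTendsto_iff.1 hw (φ.comp L)).comp hθ.tendsto_atTop)
  exact ⟨θ, hθ, this ▸ hy⟩

end Weak

/-! ### The stationary inclusion: Galerkin solutions and passage to the limit -/

section Stationary

variable {V H U : Type*} [NormedAddCommGroup V] [NormedSpace ℝ V]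
  [NormedAddCommGroup H] [InnerProductSpace ℝ H] [NormedAddCommGroup U] [NormedSpace ℝ U]
  {i : V →L[ℝ] H} {A : V → StrongDual ℝ V} {J : U → ℝ} {ι : V →L[ℝ] U} {a b α β c κ : ℝ}
  {g : StrongDual ℝ V}

/-- The bifunction of the hemivariational inequality
`κ (u, v - u)_H + ⟨A u, v - u⟩ + J⁰(ι u; ι (v - u)) ≥ ⟨g, v - u⟩`. -/
def stepForm (i : V →L[ℝ] H) (A : V → StrongDual ℝ V) (J : U → ℝ) (ι : V →L[ℝ] U) (κ : ℝ)
    (g : StrongDual ℝ V) (u v : V) : ℝ :=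
  κ * inner ℝ (i u) (i (v - u)) + A u (v - u) - g (v - u) + clarkeReal J (ι u) (ι (v - u))

lemma stepForm_self (hj : LocallyLipschitz J) (u : V) : stepForm i A J ι κ g u u = 0 := by
  simp [stepForm, hj]

lemma convexOn_stepForm (hj : LocallyLipschitz J) (u : V) :
    ConvexOn ℝ Set.univ (stepForm i A J ι κ g u) := by
  refine ⟨convex_univ, fun v _ w _ s t hs ht hst => ?_⟩
  have h1 : s • v + t • w - u = s • (v - u) + t • (w - u) := by
    nth_rewrite 1 [← one_smul ℝ u, ← hst]
    module
  have h2 := (convexOn_clarkeReal hj (ι u)).2 (Set.mem_univ (ι (v - u)))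
    (Set.mem_univ (ι (w - u))) hs ht hst
  simp only [smul_eq_mul] at h2
  simp only [stepForm, h1, map_add, map_smul, inner_add_right, inner_smul_right, smul_eq_mul]
  linarith

lemma upperSemicontinuous_stepForm_right (hj : LocallyLipschitz J) (u : V) :
    UpperSemicontinuous (stepForm i A J ι κ g u) := by
  refine UpperSemicontinuous.add (Continuous.upperSemicontinuous ?_)
    (UpperSemicontinuous.clarkeReal_comp hj (by fun_prop) (by fun_prop))
  fun_prop

lemma HypA.continuous_eval (hA : HypA i A a b α β) (F : Submodule ℝ V) [FiniteDimensional ℝ F]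
    (y : V) : Continuous fun u : F => A u y := by
  have h1 := hA.pseudomonotone.usc F inferInstance
  simp only [Set.image_singleton] at h1
  have h2 := continuousOn_iff_continuous_domRestrict.1 (upperHemicontinuousOn_singleton_iff.1 h1)
  exact (WeakBilin.eval_continuous (topDualPairing ℝ (StrongDual ℝ V)).flip
    (NormedSpace.inclusionInDoubleDual ℝ V y)).comp h2

/-- Weak continuity of `A` on `F` handles the fixed vector `L u₀`; local boundedness of `A` handles
the increment `L u - L u₀`. -/
lemma HypA.continuous_apply (hA : HypA i A a b α β) (F : Submodule ℝ V) [FiniteDimensional ℝ F]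
    {L : F → V} (hL : Continuous L) : Continuous fun u : F => A u (L u) := by
  rw [continuous_iff_continuousAt]
  intro u₀
  have h1 : Tendsto (fun u : F => A u (L u - L u₀)) (𝓝 u₀) (𝓝 0) := by
    refine squeeze_zero_norm (a := fun u : F => (a + b * ‖(u : V)‖) * ‖L u - L u₀‖) (fun u => ?_) ?_
    · exact ((A u).le_opNorm _).trans
        (mul_le_mul_of_nonneg_right (hA.growth u) (norm_nonneg _))
    · exact Continuous.tendsto' (by fun_prop) _ _ (by simp)
  have h2 := ((hA.continuous_eval F (L u₀)).tendsto u₀).add h1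
  simp only [map_sub, add_sub_cancel, add_zero] at h2
  exact h2

lemma HypA.upperSemicontinuous_stepForm_left (hA : HypA i A a b α β) (hj : LocallyLipschitz J)
    (F : Submodule ℝ V) [FiniteDimensional ℝ F] (v : V) :
    UpperSemicontinuous fun u : F => stepForm i A J ι κ g u v := by
  refine UpperSemicontinuous.add (Continuous.upperSemicontinuous ?_)
    (UpperSemicontinuous.clarkeReal_comp hj (by fun_prop) (by fun_prop))
  have := hA.continuous_apply F (L := fun u => v - u) (by fun_prop)
  exact ((show Continuous fun u : F => κ * inner ℝ (i (u : V)) (i (v - u)) by fun_prop).add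
    this).sub (by fun_prop)

/-- Passage to the limit in the hemivariational inequality along weakly convergent approximate
solutions. -/
theorem stepForm_nonneg_of_weakTendsto (hA : HypA i A a b α β) (hJ : HypJ J c)
    {u : ℕ → V} {u₀ : V} {R : ℝ} (hR : ∀ n, ‖u n‖ ≤ R) (hu : WeakTendsto u u₀)
    (hi : Tendsto (fun n => i (u n)) atTop (𝓝 (i u₀)))
    (hι : Tendsto (fun n => ι (u n)) atTop (𝓝 (ι u₀))) {S : Set V} (hS : Dense S)
    (hΦ : ∀ v ∈ S, ∀ᶠ n in atTop, 0 ≤ stepForm i A J ι κ g (u n) v) (v : V) :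
    0 ≤ stepForm i A J ι κ g u₀ v := by
  have hj := hJ.locallyLipschitz
  have hR0 : 0 ≤ R := (norm_nonneg _).trans (hR 0)
  have hbR : 0 ≤ a + b * R := add_nonneg hA.a_nonneg (mul_nonneg hA.b_pos.le hR0)
  have hg := weakTendsto_iff.1 hu g
  have hlin : ∀ w, Tendsto (fun n => κ * inner ℝ (i (u n)) (i (w - u n)) - g (w - u n)) atTop
      (𝓝 (κ * inner ℝ (i u₀) (i (w - u₀)) - g (w - u₀))) := fun w => by
    simp only [map_sub]
    exact ((hi.inner (tendsto_const_nhds.sub hi)).const_mul κ).sub (tendsto_const_nhds.sub hg)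
  have hιw : ∀ w, Tendsto (fun n => ι (w - u n)) atTop (𝓝 (ι (w - u₀))) := fun w => by
    simp only [map_sub]
    exact tendsto_const_nhds.sub hι
  have hlimsup : limsup (fun n => ((A (u n) (u n - u₀) : ℝ) : EReal)) atTop ≤ 0 := by
    -- `ρ w` is the limit of upper bounds for `⟨A uₙ, uₙ - u₀⟩` obtained by testing with `w`. It
    -- vanishes at `u₀`, so density makes it arbitrarily small.
    set ρ : V → ℝ := fun w => κ * inner ℝ (i u₀) (i (w - u₀)) - g (w - u₀)
      + c * (1 + ‖ι u₀‖) * ‖ι (w - u₀)‖ + (a + b * R) * ‖w - u₀‖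
    have hρ : Continuous ρ := by fun_prop
    have hρ0 : ρ u₀ = 0 := by simp [ρ]
    refine EReal.le_of_forall_lt_iff_le.1 fun δ hδ => ?_
    have hδ : 0 < δ := by exact_mod_cast hδ
    obtain ⟨w, hwδ, hwS⟩ := hS.inter_open_nonempty {w | ρ w < δ} (isOpen_lt hρ continuous_const)
      ⟨u₀, by simpa [hρ0] using hδ⟩
    have hlim : Tendsto (fun n => κ * inner ℝ (i (u n)) (i (w - u n)) - g (w - u n)
        + c * (1 + ‖ι (u n)‖) * ‖ι (w - u n)‖ + (a + b * R) * ‖w - u₀‖) atTop (𝓝 (ρ w)) :=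
      ((hlin w).add (((hι.norm.const_add 1).const_mul c).mul (hιw w).norm)).add_const _
    refine limsup_le_of_le (h := ?_)
    filter_upwards [hΦ w hwS, hlim.eventually_lt_const hwδ] with n h1 h2
    refine EReal.coe_le_coe_iff.2 (le_trans ?_ h2.le)
    have h3 := hJ.clarkeReal_le (ι (u n)) (ι (w - u n))
    have h4 : A (u n) (w - u₀) ≤ (a + b * R) * ‖w - u₀‖ := by
      refine (le_abs_self _).trans (((A (u n)).le_opNorm _).trans ?_)
      refine mul_le_mul_of_nonneg_right ((hA.growth _).trans ?_) (norm_nonneg _)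
      have := mul_le_mul_of_nonneg_left (hR n) hA.b_pos.le
      linarith
    have h5 : A (u n) (u n - u₀) = A (u n) (w - u₀) - A (u n) (w - u n) := by
      rw [← map_sub]
      congr 1
      abel
    rw [h5]
    unfold stepForm at h1
    linarith
  have hmem : ∀ y ∈ S, 0 ≤ stepForm i A J ι κ g u₀ y := fun y hy => by
    obtain ⟨w₀, rfl, hw₀⟩ := hA.pseudomonotone.liminf_ge u u₀ (fun n => A (u n)) hu
      (fun n => rfl) hlimsup y
    by_contra! hneg
    -- One third of the gap pays for the linear terms and one for Clarke's derivative; the last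
    -- contradicts the liminf inequality.
    set ε := -stepForm i A J ι κ g u₀ y / 3 with hε
    have hε0 : 0 < ε := by linarith
    have h1 := (upperSemicontinuous_clarkeReal hj) (ι u₀, ι (y - u₀))
      (clarkeReal J (ι u₀) (ι (y - u₀)) + ε) (by simpa using hε0)
    have h2 := (hι.prodMk_nhds (hιw y)).eventually h1
    have h3 := (hlin y).eventually_lt_const (lt_add_of_pos_right _ hε0)
    have h4 : liminf (fun n => ((A (u n) (u n - y) : ℝ) : EReal)) atTop
        ≤ ((A u₀ (u₀ - y) - ε : ℝ) : EReal) := by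
      refine liminf_le_of_frequently_le' (Eventually.frequently ?_)
      filter_upwards [h2, h3, hΦ y hy] with n hn2 hn3 hn
      refine EReal.coe_le_coe_iff.2 ?_
      have h5 : A (u n) (u n - y) = -A (u n) (y - u n) := by rw [← map_neg, neg_sub]
      have h6 : A u₀ (u₀ - y) = -A u₀ (y - u₀) := by rw [← map_neg, neg_sub]
      unfold stepForm at hn hε
      rw [h5, h6]
      linarith
    have h5 := EReal.coe_le_coe_iff.1 (hw₀.trans h4)
    linarith
  by_contra! hneg
  obtain ⟨y, hy0, hyS⟩ := hS.inter_open_nonempty {y | stepForm i A J ι κ g u₀ y < 0}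
    ((upperSemicontinuous_stepForm_right hj u₀).isOpen_preimage 0) ⟨v, hneg⟩
  exact absurd (hmem y hyS) (not_le.2 hy0)

/-- Solvability of the stationary inclusion `κ u + A u + ι* ∂J(ι u) ∋ g`, given an a priori
bound. -/
theorem exists_solution_of_bound [TopologicalSpace.SeparableSpace V] (hV : IsReflexiveSpace V)
    (hi : IsCompactOperator i) (hι : IsCompactOperator ι) (hA : HypA i A a b α β) (hJ : HypJ J c)
    {R : ℝ} (hR : ∀ u, 0 ≤ stepForm i A J ι κ g u 0 → ‖u‖ < R) :
    ∃ u, ∃ ξ ∈ clarkeSubdiff J (ι u), ∀ v,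
      κ * inner ℝ (i u) (i v) + A u v + ξ (ι v) = g v := by
  have hj := hJ.locallyLipschitz
  set e := TopologicalSpace.denseSeq V
  set F : ℕ → Submodule ℝ V := fun n => Submodule.span ℝ (e '' Set.Iio n)
  have hF : ∀ n, FiniteDimensional ℝ (F n) := fun n =>
    FiniteDimensional.span_of_finite ℝ ((Set.finite_Iio n).image e)
  have hgal : ∀ n, ∃ u : V, ‖u‖ < R ∧ ∀ v ∈ F n, 0 ≤ stepForm i A J ι κ g u v := fun n => by
    obtain ⟨u, hu, huv⟩ := exists_forall_nonneg_of_convexOn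
      (Φ := fun u v : F n => stepForm i A J ι κ g u v)
      (fun v => hA.upperSemicontinuous_stepForm_left hj (F n) v)
      (fun u => (convexOn_stepForm hj (u : V)).comp_linearMap (F n).subtype)
      (fun u => stepForm_self hj _) (fun u hu => hR u hu)
    exact ⟨u, hu, fun v hv => huv ⟨v, hv⟩⟩
  choose u hu huv using hgal
  obtain ⟨u₀, θ, hθ, hw⟩ := hV.exists_weakTendsto_subseq (fun n => (hu n).le)
  obtain ⟨θ₁, hθ₁, hi₁⟩ := exists_tendsto_subseq_of_isCompactOperator hi
    (fun n => (hu (θ n)).le) hw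
  have hw₁ : WeakTendsto (u ∘ θ ∘ θ₁) u₀ := hw.comp hθ₁.tendsto_atTop
  obtain ⟨θ₂, hθ₂, hι₂⟩ := exists_tendsto_subseq_of_isCompactOperator hι
    (fun n => (hu (θ (θ₁ n))).le) hw₁
  have hθ' : StrictMono (θ ∘ θ₁ ∘ θ₂) := hθ.comp (hθ₁.comp hθ₂)
  have hsol := stepForm_nonneg_of_weakTendsto (κ := κ) (g := g) hA hJ
    (u := u ∘ θ ∘ θ₁ ∘ θ₂) (fun n => (hu _).le)
    (hw₁.comp hθ₂.tendsto_atTop) (hi₁.comp hθ₂.tendsto_atTop) hι₂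
    (TopologicalSpace.denseRange_denseSeq V) (by
      rintro _ ⟨k, rfl⟩
      filter_upwards [hθ'.tendsto_atTop.eventually_gt_atTop k] with n hn
      exact huv _ _ (Submodule.subset_span ⟨k, hn, rfl⟩))
  -- Taking `v = u₀ + w` turns the inequality into domination of a linear functional by Clarke's
  -- derivative along `ι`.
  obtain ⟨ξ, hξ, hξv⟩ := exists_mem_clarkeSubdiff hj (ι u₀) (ι : V →ₗ[ℝ] U)
    ((g - κ • (innerSL ℝ (i u₀)).comp i - A u₀ : StrongDual ℝ V) : V →ₗ[ℝ] ℝ) (fun w => by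
      have := hsol (u₀ + w)
      simp only [stepForm, add_sub_cancel_left] at this
      simp
      linarith)
  refine ⟨u₀, ξ, hξ, fun v => ?_⟩
  have := hξv v
  simp at this
  linarith

end Stationary

/-! ### Coercivity for small time steps, and the full scheme -/

/-- A power with exponent below two is absorbed by any multiple of the square. -/
lemma exists_rpow_le_mul_sq_add {σ δ : ℝ} (hσ0 : 0 ≤ σ) (hσ : σ < 2) (hδ : 0 < δ) :
    ∃ M, 0 ≤ M ∧ ∀ y : ℝ, 0 ≤ y → y ^ σ ≤ δ * y ^ 2 + M := by
  obtain ⟨y₀, hy₀⟩ := eventually_atTop.1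
    (((tendsto_rpow_neg_atTop (sub_pos.2 hσ)).eventually_lt_const hδ).and (eventually_gt_atTop 0))
  have hy₀0 : 0 < y₀ := (hy₀ y₀ le_rfl).2
  refine ⟨y₀ ^ σ, by positivity, fun y hy => ?_⟩
  rcases le_total y y₀ with h | h
  · have := Real.rpow_le_rpow hy h hσ0
    nlinarith [sq_nonneg y]
  · obtain ⟨h1, h2⟩ := hy₀ y h
    have h3 : y ^ σ = y ^ (-(2 - σ)) * y ^ 2 := by
      rw [← Real.rpow_natCast y 2, ← Real.rpow_add h2]
      norm_num
    have h4 : 0 ≤ y₀ ^ σ := by positivity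
    rw [h3]
    have := mul_le_mul_of_nonneg_right h1.le (sq_nonneg y)
    linarith

section Stationary

variable {V H U : Type*} [NormedAddCommGroup V] [NormedSpace ℝ V]
  [NormedAddCommGroup H] [InnerProductSpace ℝ H] [NormedAddCommGroup U] [NormedSpace ℝ U]
  {i : V →L[ℝ] H} {A : V → StrongDual ℝ V} {J : U → ℝ} {ι : V →L[ℝ] U} {a b α β c : ℝ}

/-- Coercivity of the time-discrete operator for small time steps. -/
lemma HypAux.exists_coercive (hA : HypA i A a b α β) (hJ : HypJ J c) (haux : HypAux i ι J α c) :
    ∃ τ₀ α' K : ℝ, 0 < τ₀ ∧ 0 < α' ∧ 0 ≤ K ∧ ∀ τ, 0 < τ → τ < τ₀ → ∀ u : V,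
      α' * ‖u‖ ^ 2 ≤
        τ⁻¹ * ‖i u‖ ^ 2 + A u u - clarkeReal J (ι u) (-ι u) + K * (1 + ‖u‖) := by
  have hc := hJ.c_pos
  have hβ := hA.β_nonneg
  have hα := hA.α_pos
  -- For small `τ` the term `τ⁻¹ ‖i u‖²` absorbs any fixed multiple of `‖i u‖²`: the `β` term
  -- always, and under A) also the quadratic growth of `J`.
  have hinv : ∀ {B τ : ℝ}, 0 ≤ B → 0 < τ → τ < (B + 1)⁻¹ → ∀ h : ℝ,
      B * h ^ 2 ≤ τ⁻¹ * h ^ 2 := fun {B τ} hB hτ hτB h => by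
    have h1 : B + 1 < τ⁻¹ := (lt_inv_comm₀ hτ (by positivity)).1 hτB
    exact mul_le_mul_of_nonneg_right (by linarith) (sq_nonneg h)
  have hJu : ∀ u, clarkeReal J (ι u) (-ι u) ≤ c * (1 + ‖ι u‖) * ‖ι u‖ := fun u => by
    simpa using hJ.clarkeReal_le (ι u) (-ι u)
  rcases haux with ⟨p, hp⟩ | hB | ⟨d, σ, hd, hσ1, hσ2, hσ⟩
  · refine ⟨(β + 2 * c * ‖p‖ ^ 2 + 1)⁻¹, α, c, by positivity, hα, hc.le, fun τ hτ hτ₀ u => ?_⟩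
    have h1 := hinv (by positivity) hτ hτ₀ ‖i u‖
    have h2 := hA.coercive u
    have h3 : ‖ι u‖ ≤ ‖p‖ * ‖i u‖ := by
      rw [← hp]
      exact p.le_opNorm _
    have h4 : (1 + ‖ι u‖) * ‖ι u‖ ≤ 1 + 2 * (‖p‖ * ‖i u‖) ^ 2 := by
      nlinarith [sq_nonneg (‖ι u‖ - 1), norm_nonneg (ι u)]
    have h5 := mul_le_mul_of_nonneg_left h4 hc.le
    have h6 := hJu u
    have h7 : 0 ≤ c * ‖u‖ := by positivity
    linarith
  · refine ⟨(β + 1)⁻¹, α - c * ‖ι‖ ^ 2, c * ‖ι‖, by positivity, sub_pos.2 hB, by positivity,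
      fun τ hτ hτ₀ u => ?_⟩
    have h1 := hinv hβ hτ hτ₀ ‖i u‖
    have h2 := hA.coercive u
    have h3 := ι.le_opNorm u
    have h4 : (1 + ‖ι u‖) * ‖ι u‖ ≤ (1 + ‖ι‖ * ‖u‖) * (‖ι‖ * ‖u‖) := by gcongr
    have h5 := mul_le_mul_of_nonneg_left h4 hc.le
    have h6 := hJu u
    have h7 : 0 ≤ c * ‖ι‖ := by positivity
    linarith
  -- This `δ` ensures `d δ ‖ι‖² ≤ α / 2`, leaving half of the coercivity of `A`.
  · set δ := α / (2 * (d * ‖ι‖ ^ 2 + 1))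
    have hδ : 0 < δ := by positivity
    obtain ⟨M, hM, hy⟩ := exists_rpow_le_mul_sq_add (by linarith) hσ2 hδ
    refine ⟨(β + 1)⁻¹, α / 2, d * (1 + M), by positivity, by positivity, by positivity,
      fun τ hτ hτ₀ u => ?_⟩
    have h1 := hinv hβ hτ hτ₀ ‖i u‖
    have h2 := hA.coercive u
    have h3 : clarkeReal J (ι u) (-ι u) ≤ d * (1 + ‖ι u‖ ^ σ) := by
      have := hσ (ι u)
      rwa [← coe_clarkeReal hJ.locallyLipschitz, EReal.coe_le_coe_iff] at this
    have h4 := mul_le_mul_of_nonneg_left (hy ‖ι u‖ (norm_nonneg _)) hd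
    have h5 : ‖ι u‖ ^ 2 ≤ ‖ι‖ ^ 2 * ‖u‖ ^ 2 := by
      rw [← mul_pow]
      exact pow_le_pow_left₀ (norm_nonneg _) (ι.le_opNorm u) 2
    have h6 := mul_le_mul_of_nonneg_left h5 (mul_nonneg hd hδ.le)
    have h7 : d * δ * ‖ι‖ ^ 2 ≤ α / 2 := by
      have : δ * (d * ‖ι‖ ^ 2 + 1) = α / 2 := by
        simp only [δ]
        field_simp
      nlinarith
    have h8 := mul_le_mul_of_nonneg_right h7 (sq_nonneg ‖u‖)
    have h9 : 0 ≤ d * (1 + M) * ‖u‖ := by positivity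
    linarith

/-- Testing with `v = 0` gives `α' ‖u‖² ≤ K (1 + ‖u‖) + ‖g‖ ‖u‖`; once `‖u‖ ≥ 1` the right side is
at most `(2 K + ‖g‖) ‖u‖`. -/
lemma norm_lt_of_stepForm_nonneg {α' K τ : ℝ} (hα' : 0 < α') (hK : 0 ≤ K) {u : V}
    (h : α' * ‖u‖ ^ 2 ≤ τ⁻¹ * ‖i u‖ ^ 2 + A u u - clarkeReal J (ι u) (-ι u) + K * (1 + ‖u‖))
    {g : StrongDual ℝ V} (hu : 0 ≤ stepForm i A J ι τ⁻¹ g u 0) :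
    ‖u‖ < 1 + (2 * K + ‖g‖) / α' := by
  simp only [stepForm, zero_sub, map_neg, inner_neg_right, real_inner_self_eq_norm_sq] at hu
  have h1 : g u ≤ ‖g‖ * ‖u‖ := (le_abs_self _).trans (g.le_opNorm u)
  by_contra! hR
  have h2 : 1 ≤ ‖u‖ := le_trans (le_add_of_nonneg_right (by positivity)) hR
  have h3 : α' * (1 + (2 * K + ‖g‖) / α') = α' + (2 * K + ‖g‖) := by field_simp
  have h4 := mul_le_mul_of_nonneg_left hR hα'.le
  rw [h3] at h4
  have h5 := mul_le_mul_of_nonneg_right h4 (norm_nonneg u)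
  have h6 := mul_le_mul_of_nonneg_left h2 hK
  nlinarith

/-- Solvability of one step of the implicit Euler scheme extends to the whole scheme. -/
lemma exists_isRotheSolution {τ : ℝ}
    (hstep : ∀ g : StrongDual ℝ V, ∃ u, ∃ ξ ∈ clarkeSubdiff J (ι u), ∀ v,
      τ⁻¹ * inner ℝ (i u) (i v) + A u v + ξ (ι v) = g v)
    (N : ℕ) (fτ : ℕ → StrongDual ℝ V) (u₀τ : V) :
    ∃ u : Fin (N + 1) → V, IsRotheSolution i A J ι τ N fτ u₀τ u := by
  choose S ξ hξ hS using hstep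
  set s : ℕ → V := fun n => Nat.rec u₀τ (fun k w => S (fτ (k + 1) + τ⁻¹ • toDualEmb i w)) n
  refine ⟨fun k => s k, rfl, fun k => ⟨_, hξ _, fun v => ?_⟩⟩
  have key : ∀ (w w' : V) (x y z : ℝ),
      τ⁻¹ * inner ℝ (i w') (i v) + x + y = z + τ⁻¹ * inner ℝ (i w) (i v) →
      inner ℝ (τ⁻¹ • (i w' - i w)) (i v) + x + y = z := fun w w' x y z h => by
    rw [real_inner_smul_left, inner_sub_left]
    linarith
  exact key _ _ _ _ _ (hS (fτ (k + 1) + τ⁻¹ • toDualEmb i (s k)) v)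

end Stationary

end Rothe
end

theorem mainTheorem6 {V H U : Type*}
    [NormedAddCommGroup V] [NormedSpace ℝ V] [CompleteSpace V] [TopologicalSpace.SeparableSpace V]
    [NormedAddCommGroup H] [InnerProductSpace ℝ H] [CompleteSpace H]
    [TopologicalSpace.SeparableSpace H]
    [NormedAddCommGroup U] [NormedSpace ℝ U] [CompleteSpace U]
    (hV : Rothe.IsReflexiveSpace V) (hU : Rothe.IsReflexiveSpace U)
    (i : V →L[ℝ] H) (hi : Rothe.IsEvolutionEmbedding i)
    (T : ℝ) (hT : 0 < T)
    (A : V → StrongDual ℝ V) (a b α β : ℝ) (hA : Rothe.HypA i A a b α β)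
    (J : U → ℝ) (c : ℝ) (hJ : Rothe.HypJ J c)
    (f : Lp (StrongDual ℝ V) 2 (Rothe.timeMeasure T)) (u₀ : H)
    (ι : V →L[ℝ] U) (hι : Rothe.HypU i T ι)
    (haux : Rothe.HypAux i ι J α c) :
    ∃ τ₀ : ℝ, 0 < τ₀ ∧
      ∀ (τ : ℕ → ℝ) (N : ℕ → ℕ) (ε : ℕ → ℝ) (ρ : ℕ → ℝ → ℝ) (u₀τ : ℕ → V),
        Rothe.IsDiscretization i T u₀ τ N ε ρ u₀τ →
        ∀ n : ℕ, τ n < τ₀ →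
          ∃ u : Fin (N n + 1) → V,
            Rothe.IsRotheSolution i A J ι (τ n) (N n)
              (fun k => Rothe.mollify T (ε n) (ρ n) f (k * τ n)) (u₀τ n) u := by
  -- The threshold is fixed before the discretization data and does not depend on `g`, so it serves
  -- every step of every scheme.
  obtain ⟨τ₀, α', K, hτ₀, hα', hK, hco⟩ := haux.exists_coercive hA hJ
  refine ⟨τ₀, hτ₀, fun τ N ε ρ u₀τ hdisc n hn => Rothe.exists_isRotheSolution (fun g => ?_) _ _ _⟩
  exact Rothe.exists_solution_of_bound hV hi.compact hι.compact hA hJ fun u =>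
    Rothe.norm_lt_of_stepForm_nonneg hα' hK (hco (τ n) (hdisc.τ_pos n) hn u)
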